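/- Consider the word RAM with read-only input, write-only output, and words of $w$ bits, where $2^w\ge K n$ for a constant $K$ depending only on the program (so word size $\log_2 n+O(1)$ suffices). The input is an unweighted directed graph $G$ on $n$ vertices, given by adjacency lists in arbitrary order (the length of each list can be queried and its head accessed in constant time, and the list can then be traversed entry by entry), together with a vertex $r$. A directed spanning tree (DST) of $G$ rooted in $r$ is a weakly connected acyclic subgraph on all vertices of $G$ in which every vertex has in-degree at most one and $r$ has in-degree zero. Lazy-initialized memory is memory of which a block of any size can be reserved in constant time; the reserved cells may hold arbitrary words until they are written. Space counts all words of working memory used, lazy-initialized or not, but neither the input nor the output. There are one program and constants $K, C$ such that, for every such input $(G,r)$ for which $G$ has a DST rooted in $r$, every admissible word size and every previous content of the memory, the program emits each edge of some DST $T$ of $G$ rooted in $r$ exactly once, emits nothing else, and halts. Moreover $T$ is a shortest-distance tree: for every vertex $v$ the distance from $r$ to $v$ in $T$ equals that in $G$. There is no preprocessing, and the delay is $O(\Delta^+)$, where $\Delta^+$ is the maximum out-degree of $G$: the first edge is emitted within $C\cdot\max(1,\Delta^+)$ steps, each further edge within $C\cdot\max(1,\Delta^+)$ steps after the previous one, and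 the program halts within $C\cdot\max(1,\Delta^+)$ steps after the last emission (after the start, if there is no edge to emit). (For $n\ge 2$ one has $\Delta^+\ge 1$, so the maximum is just $\Delta^+$.) The program uses $\Theta(n)$ cells of lazy-initialized memory and $\Theta(n)$ space in total: both quantities lie between $n/C$ and $C n$. -/

import Mathlib

/-! ## Directed graphs and directed spanning trees -/

namespace Digraph

/-- There is a directed walk with exactly `k` edges from `u` to `v`. -/
inductive WalkOfLength {V : Type*} (G : Digraph V) (u : V) : ℕ → V → Prop
  | nil : WalkOfLength G u 0 u
  | snoc {k : ℕ} {v w : V} : WalkOfLength G u k v → G.Adj v w → WalkOfLength G u (k + 1) w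

/-- The directed distance from `u` to `v` (it is `⊤` if `v` is not reachable from `u`). -/
noncomputable def distance {V : Type*} (G : Digraph V) (u v : V) : ℕ∞ :=
  ⨅ (k : ℕ) (_ : WalkOfLength G u k v), (k : ℕ∞)

/-- The out-degree `deg⁺(v)`. -/
noncomputable def outDegree {V : Type*} (G : Digraph V) (v : V) : ℕ :=
  Set.ncard {w | G.Adj v w}

/-- The maximum out-degree `Δ⁺`. -/
noncomputable def maxOutDegree {V : Type*} [Fintype V] (G : Digraph V) : ℕ :=
  Finset.univ.sup fun v => outDegree G v

/-- `T` is an out-branching of `G`: an acyclic subgraph on all vertices of `G` in which every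
vertex has in-degree at most one. -/
structure IsOutBranching {V : Type*} (G T : Digraph V) : Prop where
  le : T ≤ G
  acyclic : ∀ v, ¬ Relation.TransGen T.Adj v v
  inDegree_le_one : ∀ u u' v, T.Adj u v → T.Adj u' v → u = u'

/-- `T` is a directed spanning tree of `G` rooted in `r`: a weakly connected out-branching of `G`
in which `r` has in-degree zero. -/
structure IsDirectedSpanningTree {V : Type*} (G T : Digraph V) (r : V) : Prop
    extends IsOutBranching G T where
  weaklyConnected : T.toSimpleGraphInclusive.Connected
  root_inDegree : ∀ u, ¬ T.Adj u r

/-- A representation of `G` by adjacency lists; the order inside each list is arbitrary. -/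
structure AdjacencyLists {n : ℕ} (G : Digraph (Fin n)) where
  list : Fin n → List (Fin n)
  nodup : ∀ v, (list v).Nodup
  mem_list : ∀ v w, w ∈ list v ↔ G.Adj v w

end Digraph

/-! ## A word RAM with read-only adjacency lists and a write-only output

The machine has finitely many registers, finitely many cursors into the input lists, and a heap.
All words have `w` bits. A heap cell can be used only after it has been obtained, either singly,
in initialized form (`alloc`), or as part of a block of arbitrary length that is reserved within
one step and whose cells hold arbitrary words until the program writes to them (`reserve`).
Every instruction takes one step. -/

namespace WordRAM

/-- The arithmetic and bitwise operations on words. -/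
inductive Op
  | add | sub | mul | div | mod | and | or | xor | shl | shr

/-- The value of an operation on `w`-bit words, before reduction modulo `2 ^ w`. -/
def Op.eval (w : ℕ) : Op → ℕ → ℕ → ℕ
  | .add, a, b => a + b
  | .sub, a, b => a + (2 ^ w - b)
  | .mul, a, b => a * b
  | .div, a, b => a / b
  | .mod, a, b => a % b
  | .and, a, b => a &&& b
  | .or, a, b => a ||| b
  | .xor, a, b => a ^^^ b
  | .shl, a, b => a <<< b
  | .shr, a, b => a >>> b

/-- Instructions of a machine with `k` registers and `c` list cursors. -/
inductive Instr (k c : ℕ)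
  /-- `d := a` -/
  | const (d : Fin k) (a : ℕ)
  /-- `d := a ∘ b` -/
  | op (o : Op) (d a b : Fin k)
  /-- `d := heap[a]` -/
  | load (d a : Fin k)
  /-- `heap[a] := b` -/
  | store (a b : Fin k)
  /-- obtain one heap cell with content `a`; `d :=` its address -/
  | alloc (d a : Fin k)
  /-- reserve a block of `a` lazily initialized heap cells; `d :=` the address of the first one -/
  | reserve (d a : Fin k)
  /-- `d := n`, the number of vertices -/
  | order (d : Fin k)
  /-- `d := r`, the given root -/
  | root (d : Fin k)
  /-- `d := deg⁺(v)` -/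
  | outDegree (d v : Fin k)
  /-- place cursor `p` at the head of the adjacency list of `v` -/
  | openList (p : Fin c) (v : Fin k)
  /-- if cursor `p` is at the end of its list, go to `l`; otherwise `d :=` the entry at `p`, and
  advance `p` to the next entry -/
  | next (p : Fin c) (d : Fin k) (l : ℕ)
  /-- go to `l` -/
  | jump (l : ℕ)
  /-- if `a < b`, go to `l` -/
  | jumpLt (a b : Fin k) (l : ℕ)
  /-- if `a = b`, go to `l` -/
  | jumpEq (a b : Fin k) (l : ℕ)
  /-- output the edge `(u, v)` -/
  | emit (u v : Fin k)
  /-- stop -/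
  | halt

/-- A program, with the number of registers and of list cursors that it uses. -/
structure Program where
  numRegs : ℕ
  numCursors : ℕ
  code : List (Instr numRegs numCursors)

/-- The input: a directed graph on the vertices `0, …, order - 1` in the form of adjacency lists,
and a vertex of it. -/
structure Input where
  order : ℕ
  root : Fin order
  adj : Fin order → List (Fin order)

/-- The status of a computation. `fault` is an illegal operation: an access to a heap cell that
has not been obtained, a request for more heap cells than there are addresses, the use of a number
that is not a vertex as a vertex, or a jump out of the program. -/
inductive Status
  | running | halted | fault

/-- Configurations of a machine with `k` registers and `c` list cursors. -/
structure Config (k c : ℕ) where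
  status : Status
  pc : ℕ
  regs : Fin k → ℕ
  /-- a cursor, represented by the rest of the list that it points into -/
  cursors : Fin c → List ℕ
  heap : ℕ → ℕ
  /-- the number of heap cells obtained so far; these have the addresses `0, …, top - 1` -/
  top : ℕ
  /-- the number of heap cells that were obtained as lazily initialized memory -/
  lazy : ℕ
  /-- the edges emitted so far, in the order of emission -/
  out : List (ℕ × ℕ)

namespace Config

variable {k c : ℕ}

/-- Stop with an error. -/
def err (s : Config k c) : Config k c := { s with status := .fault }

/-- Continue with the next instruction. -/
def adv (s : Config k c) : Config k c := { s with pc := s.pc + 1 }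

/-- Continue with instruction `l`. -/
def goto (s : Config k c) (l : ℕ) : Config k c := { s with pc := l }

/-- Write a value, reduced to `w` bits, to a register. -/
def setReg (s : Config k c) (w : ℕ) (d : Fin k) (a : ℕ) : Config k c :=
  { s with regs := Function.update s.regs d (a % 2 ^ w) }

end Config

/-- The effect of one instruction. -/
def exec {k c : ℕ} (w : ℕ) (I : Input) (s : Config k c) : Instr k c → Config k c
  | .const d a => (s.setReg w d a).adv
  | .op o d a b => (s.setReg w d (o.eval w (s.regs a) (s.regs b))).adv
  | .load d a =>
      if s.regs a < s.top then (s.setReg w d (s.heap (s.regs a))).adv else s.err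
  | .store a b =>
      if s.regs a < s.top then
        Config.adv { s with heap := Function.update s.heap (s.regs a) (s.regs b) }
      else s.err
  | .alloc d a =>
      if s.top + 1 ≤ 2 ^ w then
        (Config.setReg { s with heap := Function.update s.heap s.top (s.regs a),
                                top := s.top + 1 } w d s.top).adv
      else s.err
  | .reserve d a =>
      if s.top + s.regs a ≤ 2 ^ w then
        (Config.setReg { s with top := s.top + s.regs a,
                                lazy := s.lazy + s.regs a } w d s.top).adv
      else s.err
  | .order d => (s.setReg w d I.order).adv
  | .root d => (s.setReg w d I.root).adv
  | .outDegree d v =>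
      if h : s.regs v < I.order then (s.setReg w d (I.adj ⟨s.regs v, h⟩).length).adv else s.err
  | .openList p v =>
      if h : s.regs v < I.order then
        Config.adv
          { s with
            cursors := Function.update s.cursors p ((I.adj ⟨s.regs v, h⟩).map Fin.val) }
      else s.err
  | .next p d l =>
      match s.cursors p with
      | [] => s.goto l
      | x :: xs =>
          (Config.setReg { s with cursors := Function.update s.cursors p xs } w d x).adv
  | .jump l => s.goto l
  | .jumpLt a b l => if s.regs a < s.regs b then s.goto l else s.adv
  | .jumpEq a b l => if s.regs a = s.regs b then s.goto l else s.adv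
  | .emit u v => Config.adv { s with out := s.out ++ [(s.regs u, s.regs v)] }
  | .halt => { s with status := .halted }

/-- One step of a computation; configurations that are not running do not change. -/
def step (P : Program) (w : ℕ) (I : Input) (s : Config P.numRegs P.numCursors) :
    Config P.numRegs P.numCursors :=
  match s.status with
  | .running =>
      match P.code[s.pc]? with
      | some i => exec w I s i
      | none => s.err
  | _ => s

/-- The initial configuration; `junk` is the previous content of the memory. -/
def init (P : Program) (w : ℕ) (junk : ℕ → ℕ) : Config P.numRegs P.numCursors where
  status := .running
  pc := 0
  regs := fun _ => 0
  cursors := fun _ => []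
  heap := fun a => junk a % 2 ^ w
  top := 0
  lazy := 0
  out := []

/-- The configuration after `t` steps. -/
def run (P : Program) (w : ℕ) (I : Input) (junk : ℕ → ℕ) (t : ℕ) :
    Config P.numRegs P.numCursors :=
  (step P w I)^[t] (init P w junk)

/-- The number of words of working memory in use: the registers, the cursors (a cursor is given
by a vertex and a position in its adjacency list), and the heap cells obtained so far. Since heap
cells are never given back, this does not decrease during a computation. -/
def space (P : Program) (s : Config P.numRegs P.numCursors) : ℕ :=
  P.numRegs + 2 * P.numCursors + s.top

/-- Preprocessing time at most `p` and delay at most `d`: after the first `p` steps, it never takes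
more than `d` steps until the next edge is emitted, or, after the last edge, until the program
halts. -/
def PreprocessingDelayLE (P : Program) (w : ℕ) (I : Input) (junk : ℕ → ℕ) (p d : ℕ) : Prop :=
  ∀ t, p ≤ t →
    (run P w I junk t).out.length < (run P w I junk (t + d)).out.length ∨
      (run P w I junk (t + d)).status = .halted

/-- `s` is a halted configuration in which each edge of `T`, and nothing else, has been emitted
exactly once. -/
def HasEnumerated {k c n : ℕ} (s : Config k c) (T : Digraph (Fin n)) : Prop :=
  s.status = .halted ∧
    ∃ L : List (Fin n × Fin n), L.Nodup ∧ (∀ u v, (u, v) ∈ L ↔ T.Adj u v) ∧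
      s.out = L.map fun e => (e.1.val, e.2.val)

end WordRAM

/-!
The tree is found by breadth-first search. A plain search may have to scan many out-lists in a row
without discovering a vertex, so the edge to a vertex is not emitted when the vertex is discovered
but when it is taken from the queue. As every vertex other than the root is taken from the queue
exactly once, and scanning one out-list takes `O(Δ⁺)` steps, the delay is `O(Δ⁺)`: the queue itself
serves as the buffer of edges (`WordRAM.IsPopped.exists_iterate`).

The memory is not initialized. A vertex `v` counts as discovered if its index cell holds a position
`i` below the tail of the queue and the queue holds `v` at `i`; arbitrary contents cannot forge this,
as the cells of the queue below the tail have been written (`WordRAM.exists_iterate_scan`).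

That the tree preserves distances follows from the order of the queue alone. The positions of the
parents are monotone along the queue, hence so are the depths
(`Digraph.IsBFSState.bfsDepth_mono`), and an edge out of the `j`-th vertex leads to a vertex whose
parent is not later than `j`; so a walk of length `k` ends at depth at most `k`
(`Digraph.IsBFSState.bfsDepth_le_of_walkOfLength`).
-/

/-! ### Breadth-first search as a numbering of the vertices -/

namespace Digraph

variable {V : Type*} {G T₀ : Digraph V} {r : V}

/-- A state of breadth-first search from `r`: the vertices discovered so far are
`q 0, …, q (t - 1)` in order of discovery, `q (p i)` is the parent of `q i` for `0 < i < t`, the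
out-lists of `q 0, …, q (h - 1)` have been scanned completely, and of the out-list of `q h` the
vertices in `done` have been scanned. Parents are recorded by their position in the queue, so that
monotonicity of `p` expresses the first-in-first-out discipline. -/
structure IsBFSState (G : Digraph V) (r : V) (q : ℕ → V) (p : ℕ → ℕ) (h t : ℕ) (done : List V) :
    Prop where
  pos : 0 < t
  zero : q 0 = r
  inj : ∀ i < t, ∀ j < t, q i = q j → i = j
  parent_lt : ∀ i, 0 < i → i < t → p i < i
  parent_le : ∀ i, 0 < i → i < t → p i ≤ h
  adj : ∀ i, 0 < i → i < t → G.Adj (q (p i)) (q i)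
  mono : ∀ i j, 0 < i → i ≤ j → j < t → p i ≤ p j
  closed : ∀ j < h, ∀ v, G.Adj (q j) v → ∃ i < t, q i = v ∧ (0 < i → p i ≤ j)
  closed_done : ∀ v ∈ done, ∃ i < t, q i = v

namespace IsBFSState

variable {q : ℕ → V} {p : ℕ → ℕ} {h t : ℕ} {done : List V}

theorem initial (G : Digraph V) (r : V) : IsBFSState G r (fun _ => r) (fun _ => 0) 0 1 [] := by
  constructor <;> intros <;> first | rfl | lia | simp_all

theorem congr {q' : ℕ → V} {p' : ℕ → ℕ} (hs : IsBFSState G r q p h t done) (hht : h ≤ t)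
    (hq : ∀ i < t, q' i = q i) (hp : ∀ i < t, p' i = p i) :
    IsBFSState G r q' p' h t done where
  pos := hs.pos
  zero := by rw [hq 0 hs.pos, hs.zero]
  inj i hi j hj := by rw [hq i hi, hq j hj]; exact hs.inj i hi j hj
  parent_lt i h0 hi := by rw [hp i hi]; exact hs.parent_lt i h0 hi
  parent_le i h0 hi := by rw [hp i hi]; exact hs.parent_le i h0 hi
  adj i h0 hi := by
    rw [hp i hi, hq i hi, hq _ ((hs.parent_lt i h0 hi).trans hi)]; exact hs.adj i h0 hi
  mono i j h0 hij hj := by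
    rw [hp i (hij.trans_lt hj), hp j hj]; exact hs.mono i j h0 hij hj
  closed j hj v hv := by
    rw [hq j (hj.trans_le hht)] at hv
    obtain ⟨i, hi, h1, h2⟩ := hs.closed j hj v hv
    exact ⟨i, hi, by rw [hq i hi, h1], by rw [hp i hi]; exact h2⟩
  closed_done v hv := by
    obtain ⟨i, hi, h1⟩ := hs.closed_done v hv
    exact ⟨i, hi, by rw [hq i hi, h1]⟩

theorem skip (hs : IsBFSState G r q p h t done) {v : V} (hv : ∃ i < t, q i = v) :
    IsBFSState G r q p h t (v :: done) :=
  { hs with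
    closed_done := by
      intro w hw
      rcases List.mem_cons.1 hw with rfl | hw
      · exact hv
      · exact hs.closed_done w hw }

theorem append (hs : IsBFSState G r q p h t done) (hht : h < t) {v : V} (hadj : G.Adj (q h) v)
    (hv : ∀ i < t, q i ≠ v) :
    IsBFSState G r (Function.update q t v) (Function.update p t h) h (t + 1) (v :: done) := by
  have hq : ∀ i < t, Function.update q t v i = q i := fun i hi =>
    Function.update_of_ne hi.ne _ _
  have hp : ∀ i < t, Function.update p t h i = p i := fun i hi =>
    Function.update_of_ne hi.ne _ _
  have hs' := hs.congr hht.le hq hp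
  have hqt : Function.update q t v t = v := Function.update_self _ _ _
  have hpt : Function.update p t h t = h := Function.update_self _ _ _
  generalize Function.update q t v = q' at *
  generalize Function.update p t h = p' at *
  constructor
  · lia
  · exact hs'.zero
  · intro i hi j hj hij
    rcases Nat.lt_succ_iff_lt_or_eq.1 hi with hi | rfl <;>
      rcases Nat.lt_succ_iff_lt_or_eq.1 hj with hj | rfl
    · exact hs'.inj i hi j hj hij
    · rw [hqt, hq i hi] at hij; exact absurd hij (hv i hi)
    · rw [hqt, hq j hj] at hij; exact absurd hij.symm (hv j hj)
    · rfl
  · intro i h0 hi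
    rcases Nat.lt_succ_iff_lt_or_eq.1 hi with hi | rfl
    · exact hs'.parent_lt i h0 hi
    · lia
  · intro i h0 hi
    rcases Nat.lt_succ_iff_lt_or_eq.1 hi with hi | rfl
    · exact hs'.parent_le i h0 hi
    · lia
  · intro i h0 hi
    rcases Nat.lt_succ_iff_lt_or_eq.1 hi with hi | rfl
    · exact hs'.adj i h0 hi
    · rw [hpt, hqt, hq h hht]; exact hadj
  · intro i j h0 hij hj
    rcases Nat.lt_succ_iff_lt_or_eq.1 hj with hj | rfl
    · exact hs'.mono i j h0 hij hj
    · rcases hij.lt_or_eq with hi | rfl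
      · rw [hpt]; exact hs'.parent_le i h0 hi
      · rfl
  · intro j hj w hw
    obtain ⟨i, hi, h1⟩ := hs'.closed j hj w hw
    exact ⟨i, by lia, h1⟩
  · intro w hw
    rcases List.mem_cons.1 hw with rfl | hw
    · exact ⟨t, by lia, hqt⟩
    · obtain ⟨i, hi, h1⟩ := hs'.closed_done w hw
      exact ⟨i, by lia, h1⟩

theorem advance (hs : IsBFSState G r q p h t done) (hdone : ∀ v, G.Adj (q h) v → v ∈ done) :
    IsBFSState G r q p (h + 1) t [] :=
  { hs with
    parent_le := fun i h0 hi => (hs.parent_le i h0 hi).trans h.le_succ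
    closed := by
      intro j hj v hv
      rcases Nat.lt_succ_iff_lt_or_eq.1 hj with hj | rfl
      · exact hs.closed j hj v hv
      · obtain ⟨i, hi, h1⟩ := hs.closed_done v (hdone v hv)
        exact ⟨i, hi, h1, fun h0 => hs.parent_le i h0 hi⟩
    closed_done := by simp }

theorem le_card [Fintype V] (hs : IsBFSState G r q p h t done) : t ≤ Fintype.card V := by
  have hinj : Function.Injective fun i : Fin t => q i := fun i j hij =>
    Fin.ext (hs.inj i i.2 j j.2 hij)
  simpa using Fintype.card_le_of_injective _ hinj

end IsBFSState

/-! ### The tree of a breadth-first search -/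

/-- The graph with the edges from parents to children of a state of breadth-first search. -/
def bfsTree (q : ℕ → V) (p : ℕ → ℕ) (t : ℕ) : Digraph V where
  Adj u v := ∃ i, 0 < i ∧ i < t ∧ q (p i) = u ∧ q i = v

/-- The depth of the `i`-th discovered vertex in the tree with the parent positions `p`; the test
`p (i + 1) < i + 1` only serves the termination of the recursion. -/
def bfsDepth (p : ℕ → ℕ) : ℕ → ℕ
  | 0 => 0
  | i + 1 => if p (i + 1) < i + 1 then bfsDepth p (p (i + 1)) + 1 else 0

theorem WalkOfLength.mono {G H : Digraph V} (hGH : G ≤ H) {u v : V} {k : ℕ}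
    (hw : G.WalkOfLength u k v) : H.WalkOfLength u k v := by
  induction hw with
  | nil => exact .nil
  | snoc _ hadj ih => exact ih.snoc (hGH hadj)

theorem IsDirectedSpanningTree.exists_walkOfLength (hT : G.IsDirectedSpanningTree T₀ r) (v : V) :
    ∃ k, G.WalkOfLength r k v := by
  suffices hs : ∃ k, T₀.WalkOfLength r k v from hs.imp fun _ hk => hk.mono hT.le
  obtain ⟨walk⟩ := hT.weaklyConnected.preconnected v r
  induction walk with
  | nil => exact ⟨0, .nil⟩
  | cons hadj _ ih =>
    obtain ⟨k, hk⟩ := ih hT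
    rcases hadj.2 with huv | hvu
    -- the tree edge into the reachable vertex is the last edge of the walk that reaches it
    · cases hk with
      | nil => exact absurd huv (hT.root_inDegree _)
      | snoc hk' hadj' => rw [hT.inDegree_le_one _ _ _ huv hadj']; exact ⟨_, hk'⟩
    · exact ⟨_, hk.snoc hvu⟩

namespace IsBFSState

variable {q : ℕ → V} {p : ℕ → ℕ} {t : ℕ}

theorem bfsTree_le {h : ℕ} {done : List V} (hs : IsBFSState G r q p h t done) :
    bfsTree q p t ≤ G := by
  rintro _ _ ⟨i, h0, hi, rfl, rfl⟩
  exact hs.adj i h0 hi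

theorem bfsDepth_eq {h : ℕ} {done : List V} (hs : IsBFSState G r q p h t done) {i : ℕ}
    (h0 : 0 < i) (hi : i < t) : bfsDepth p i = bfsDepth p (p i) + 1 := by
  obtain ⟨i, rfl⟩ := Nat.exists_eq_add_of_lt h0
  have := hs.parent_lt _ h0 hi
  simp only [zero_add] at this ⊢
  rw [bfsDepth, if_pos this]

/-- Vertices are discovered in order of their depth. -/
theorem bfsDepth_mono {h : ℕ} {done : List V} (hs : IsBFSState G r q p h t done) :
    ∀ j < t, ∀ i ≤ j, bfsDepth p i ≤ bfsDepth p j := by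
  intro j
  induction j using Nat.strong_induction_on with
  | _ j ih =>
    intro hj i hij
    rcases Nat.eq_zero_or_pos i with rfl | hi
    · simp [bfsDepth]
    · have hpj := hs.parent_lt j (hi.trans_le hij) hj
      rw [hs.bfsDepth_eq hi (hij.trans_lt hj), hs.bfsDepth_eq (hi.trans_le hij) hj]
      exact Nat.add_le_add_right (ih _ hpj (hpj.trans hj) _ (hs.mono i j hi hij hj)) 1

theorem walkOfLength_bfsTree {h : ℕ} {done : List V} (hs : IsBFSState G r q p h t done) (i : ℕ)
    (hi : i < t) : (bfsTree q p t).WalkOfLength r (bfsDepth p i) (q i) := by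
  induction i using Nat.strong_induction_on with
  | _ i ih =>
    rcases Nat.eq_zero_or_pos i with rfl | h0
    · rw [hs.zero, bfsDepth]; exact .nil
    · have hpi := hs.parent_lt i h0 hi
      rw [hs.bfsDepth_eq h0 hi]
      exact (ih _ hpi (hpi.trans hi)).snoc ⟨i, h0, hi, rfl, rfl⟩

/-- After the search, no walk from the root is shorter than the depth of its end. -/
theorem bfsDepth_le_of_walkOfLength (hs : IsBFSState G r q p t t []) {k : ℕ} {v : V}
    (hw : G.WalkOfLength r k v) : ∃ i < t, q i = v ∧ bfsDepth p i ≤ k := by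
  induction hw with
  | nil => exact ⟨0, hs.pos, hs.zero, by simp [bfsDepth]⟩
  | snoc _ hadj ih =>
    obtain ⟨j, hj, rfl, hd⟩ := ih
    obtain ⟨i, hi, rfl, hij⟩ := hs.closed j hj _ hadj
    refine ⟨i, hi, rfl, ?_⟩
    rcases Nat.eq_zero_or_pos i with rfl | h0
    · simp [bfsDepth]
    · rw [hs.bfsDepth_eq h0 hi]
      exact Nat.add_le_add_right ((hs.bfsDepth_mono j hj _ (hij h0)).trans hd) 1

theorem distance_bfsTree (hs : IsBFSState G r q p t t []) (v : V) :
    (bfsTree q p t).distance r v = G.distance r v := by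
  apply le_antisymm
  · refine le_iInf₂ fun k hk => ?_
    obtain ⟨i, hi, rfl, hd⟩ := hs.bfsDepth_le_of_walkOfLength hk
    exact (iInf₂_le (bfsDepth p i) (hs.walkOfLength_bfsTree i hi)).trans (Nat.cast_le.2 hd)
  · exact le_iInf₂ fun k hk => iInf₂_le k (hk.mono hs.bfsTree_le)

theorem isDirectedSpanningTree (hs : IsBFSState G r q p t t [])
    (hreach : ∀ v, ∃ k, G.WalkOfLength r k v) :
    G.IsDirectedSpanningTree (bfsTree q p t) r where
  le := hs.bfsTree_le
  acyclic v hv := by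
    have key : ∀ u w, Relation.TransGen (bfsTree q p t).Adj u w →
        ∃ i j, i < j ∧ j < t ∧ q i = u ∧ q j = w := by
      intro u w huw
      induction huw with
      | single hadj =>
        obtain ⟨i, h0, hi, rfl, rfl⟩ := hadj
        exact ⟨p i, i, hs.parent_lt i h0 hi, hi, rfl, rfl⟩
      | tail _ hadj ih =>
        obtain ⟨i, j, hij, hj, rfl, rfl⟩ := ih
        obtain ⟨l, h0, hl, hpl, rfl⟩ := hadj
        have hlt := hs.parent_lt l h0 hl
        have := hs.inj _ (hlt.trans hl) _ hj hpl
        exact ⟨i, l, by lia, hl, rfl, rfl⟩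
    obtain ⟨i, j, hij, hj, rfl, hji⟩ := key v v hv
    have := hs.inj _ hj _ (hij.trans hj) hji
    lia
  inDegree_le_one := by
    rintro _ _ _ ⟨i, h0, hi, rfl, rfl⟩ ⟨j, -, hj, rfl, hij⟩
    rw [hs.inj j hj i hi hij]
  weaklyConnected := by
    have key : ∀ i < t, (bfsTree q p t).toSimpleGraphInclusive.Reachable r (q i) := by
      intro i
      induction i using Nat.strong_induction_on with
      | _ i ih =>
        intro hi
        rcases Nat.eq_zero_or_pos i with rfl | h0
        · rw [hs.zero]
        · have hpi := hs.parent_lt i h0 hi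
          refine (ih _ hpi (hpi.trans hi)).trans (SimpleGraph.Adj.reachable ⟨fun heq => ?_, ?_⟩)
          · exact hpi.ne (hs.inj _ (hpi.trans hi) _ hi heq)
          · exact Or.inl ⟨i, h0, hi, rfl, rfl⟩
    have hall : ∀ v, (bfsTree q p t).toSimpleGraphInclusive.Reachable r v := by
      intro v
      obtain ⟨k, hk⟩ := hreach v
      obtain ⟨i, hi, rfl, -⟩ := hs.bfsDepth_le_of_walkOfLength hk
      exact key i hi
    have : Nonempty V := ⟨r⟩
    exact ⟨fun u v => (hall u).symm.trans (hall v)⟩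
  root_inDegree := by
    rintro _ ⟨i, h0, hi, rfl, hir⟩
    have := hs.inj i hi 0 hs.pos (hir.trans hs.zero.symm)
    lia

end IsBFSState

end Digraph

namespace WordRAM

/-! ### The program and the effect of its blocks -/

/-- Breadth-first search in which the edge to a vertex is emitted when the vertex is taken from the
queue. Registers 0 to 9 hold `n`, `2 * n`, `1`, the head `h` and the tail `t` of the queue, the
vertex `u` whose out-list is being scanned, the current entry `v` of this list, and three auxiliary
values. Jump targets are positions in the list; they are given below at the blocks they enter. -/
def bfsCode : List (Instr 10 1) := [
  -- 0: reserve `3 * n` cells and enqueue the root; `h` is still `0`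
  .order 0, .const 2 1, .op .add 1 0 0, .op .add 7 1 0, .reserve 7 7,
  .root 5, .store 3 5, .op .add 7 0 5, .store 7 3, .op .add 4 4 2,
  -- 10: start the out-list of `u`
  .openList 0 5,
  -- 11: take the next entry `v` and the queue position that its index cell claims
  .next 0 6 24, .op .add 7 0 6, .load 8 7, .jumpLt 8 4 16, .jump 18,
  -- 16: check the claim
  .load 9 8, .jumpEq 9 6 11,
  -- 18: enqueue `v` with the parent position `h`
  .store 7 4, .store 4 6, .op .add 7 1 4, .store 7 3, .op .add 4 4 2, .jump 11,
  -- 24: the out-list is finished; take the next vertex from the queue and emit its edge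
  .op .add 3 3 2, .jumpEq 3 4 32, .load 5 3, .op .add 7 1 3, .load 8 7, .load 9 8, .emit 9 5,
  .jump 10,
  -- 32
  .halt]

/-- Breadth-first search with ten registers and one list cursor. -/
abbrev bfsProgram : Program := ⟨10, 1, bfsCode⟩

/-- The register file, with the contents of the registers in the order of their numbers. -/
def registers (N N₂ one h t u v a i x : ℕ) : Fin 10 → ℕ := ![N, N₂, one, h, t, u, v, a, i, x]

/-- A running configuration after the initialization: `3 * n` cells have been reserved, and
the registers that hold constants are set. -/
def bfsConfig (n pc h t u v a i x : ℕ) (cur : List ℕ) (heap : ℕ → ℕ) (out : List (ℕ × ℕ)) :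
    Config 10 1 where
  status := .running
  pc := pc
  regs := registers n (n + n) 1 h t u v a i x
  cursors := fun _ => cur
  heap := heap
  top := n + n + n
  lazy := n + n + n
  out := out

section

variable {N N₂ one h t u v a i x y : ℕ}

theorem update_registers_zero :
    Function.update (registers N N₂ one h t u v a i x) 0 y =
      registers y N₂ one h t u v a i x := by
  funext j; fin_cases j <;> rfl

theorem update_registers_one :
    Function.update (registers N N₂ one h t u v a i x) 1 y =
      registers N y one h t u v a i x := by
  funext j; fin_cases j <;> rfl

theorem update_registers_two :
    Function.update (registers N N₂ one h t u v a i x) 2 y =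
      registers N N₂ y h t u v a i x := by
  funext j; fin_cases j <;> rfl

theorem update_registers_three :
    Function.update (registers N N₂ one h t u v a i x) 3 y =
      registers N N₂ one y t u v a i x := by
  funext j; fin_cases j <;> rfl

theorem update_registers_four :
    Function.update (registers N N₂ one h t u v a i x) 4 y =
      registers N N₂ one h y u v a i x := by
  funext j; fin_cases j <;> rfl

theorem update_registers_five :
    Function.update (registers N N₂ one h t u v a i x) 5 y =
      registers N N₂ one h t y v a i x := by
  funext j; fin_cases j <;> rfl

theorem update_registers_six :
    Function.update (registers N N₂ one h t u v a i x) 6 y =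
      registers N N₂ one h t u y a i x := by
  funext j; fin_cases j <;> rfl

theorem update_registers_seven :
    Function.update (registers N N₂ one h t u v a i x) 7 y =
      registers N N₂ one h t u v y i x := by
  funext j; fin_cases j <;> rfl

theorem update_registers_eight :
    Function.update (registers N N₂ one h t u v a i x) 8 y =
      registers N N₂ one h t u v a y x := by
  funext j; fin_cases j <;> rfl

theorem update_registers_nine :
    Function.update (registers N N₂ one h t u v a i x) 9 y =
      registers N N₂ one h t u v a i y := by
  funext j; fin_cases j <;> rfl

theorem registers_apply :
    registers N N₂ one h t u v a i x 0 = N ∧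
    registers N N₂ one h t u v a i x 1 = N₂ ∧
    registers N N₂ one h t u v a i x 2 = one ∧
    registers N N₂ one h t u v a i x 3 = h ∧
    registers N N₂ one h t u v a i x 4 = t ∧
    registers N N₂ one h t u v a i x 5 = u ∧
    registers N N₂ one h t u v a i x 6 = v ∧
    registers N N₂ one h t u v a i x 7 = a ∧
    registers N N₂ one h t u v a i x 8 = i ∧
    registers N N₂ one h t u v a i x 9 = x :=
  ⟨rfl, rfl, rfl, rfl, rfl, rfl, rfl, rfl, rfl, rfl⟩

theorem update_cursors (l l' : List ℕ) :
    Function.update (fun _ : Fin 1 => l) 0 l' = fun _ => l' := by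
  funext j; fin_cases j; rfl

end

attribute [local simp] update_registers_zero update_registers_one update_registers_two
  update_registers_three update_registers_four update_registers_five update_registers_six
  update_registers_seven update_registers_eight update_registers_nine registers_apply update_cursors
  step exec Config.setReg Config.adv Config.goto Op.eval bfsCode

variable {n w : ℕ} {r : Fin n} {adj : Fin n → List (Fin n)} {h t u v a i x : ℕ}
  {cur : List ℕ} {heap : ℕ → ℕ} {out : List (ℕ × ℕ)}

/-- Read the next list entry and the position in the queue that its index cell claims for it. -/
theorem iterate_step_lookup (hn : 4 * n ≤ 2 ^ w) (hv : v < n) {v' : ℕ} :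
    (step bfsProgram w ⟨n, r, adj⟩)^[3] (bfsConfig n 11 h t u v' a i x (v :: cur) heap out) =
      bfsConfig n 14 h t u v (n + v) (heap (n + v) % 2 ^ w) x cur heap out := by
  have h1 : v < 2 ^ w := by lia
  have h2 : n + v < 2 ^ w := by lia
  have h3 : n + v < n + n + n := by lia
  simp [Function.iterate_succ, bfsConfig, Nat.mod_eq_of_lt h1, Nat.mod_eq_of_lt h2, h3]

/-- Enqueue the vertex `v`, whose index cell has the address `a`, with the parent position `h`. -/
theorem iterate_step_append (hn : 4 * n ≤ 2 ^ w) (ht : t < n) (ha : a < n + n) :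
    (step bfsProgram w ⟨n, r, adj⟩)^[6] (bfsConfig n 18 h t u v a i x cur heap out) =
      bfsConfig n 11 h (t + 1) u v (n + n + t) i x cur
        (Function.update (Function.update (Function.update heap a t) t v) (n + n + t) h) out := by
  have h1 : a < n + n + n := by lia
  have h2 : t < n + n + n := by lia
  have h3 : n + n + t < n + n + n := by lia
  have h4 : n + n + t < 2 ^ w := by lia
  have h5 : t + 1 < 2 ^ w := by lia
  simp [Function.iterate_succ, bfsConfig, h1, h2, h3, Nat.mod_eq_of_lt h4, Nat.mod_eq_of_lt h5]

/-- The queue holds `v` at the claimed position, so that `v` is skipped. -/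
theorem iterate_step_known (hi : i < t) (ht : t ≤ n) (hv : heap i % 2 ^ w = v) :
    (step bfsProgram w ⟨n, r, adj⟩)^[3] (bfsConfig n 14 h t u v a i x cur heap out) =
      bfsConfig n 11 h t u v a i v cur heap out := by
  have h1 : i < n + n + n := by lia
  simp [Function.iterate_succ, bfsConfig, hi, h1, hv]

/-- The queue holds another vertex than `v` at the claimed position. -/
theorem iterate_step_mismatch (hi : i < t) (ht : t ≤ n) (hv : heap i % 2 ^ w ≠ v) :
    (step bfsProgram w ⟨n, r, adj⟩)^[3] (bfsConfig n 14 h t u v a i x cur heap out) =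
      bfsConfig n 18 h t u v a i (heap i % 2 ^ w) cur heap out := by
  have h1 : i < n + n + n := by lia
  simp [Function.iterate_succ, bfsConfig, hi, h1, hv]

/-- The claimed position is not a position in the queue. -/
theorem iterate_step_unknown (hi : ¬ i < t) :
    (step bfsProgram w ⟨n, r, adj⟩)^[2] (bfsConfig n 14 h t u v a i x cur heap out) =
      bfsConfig n 18 h t u v a i x cur heap out := by
  simp [Function.iterate_succ, bfsConfig, hi]

/-- At the end of an out-list, with no vertex left in the queue. -/
theorem iterate_step_halt (ht : h + 1 = t) (htw : t < 2 ^ w) :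
    (step bfsProgram w ⟨n, r, adj⟩)^[4] (bfsConfig n 11 h t u v a i x [] heap out) =
      { bfsConfig n 32 t t u v a i x [] heap out with status := .halted } := by
  subst ht
  simp [Function.iterate_succ, bfsConfig, Nat.mod_eq_of_lt htw]

/-- At the end of an out-list, the next vertex is taken from the queue, its edge is emitted and its
out-list opened. -/
theorem iterate_step_pop (hn : 4 * n ≤ 2 ^ w) (ht : h + 1 < t) (htn : t ≤ n)
    {u' : Fin n} {i' x' : ℕ}
    (hu : heap (h + 1) = u') (hi : heap (n + n + (h + 1)) = i') (hin : i' < n)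
    (hx : heap i' = x') (hxn : x' < n) :
    (step bfsProgram w ⟨n, r, adj⟩)^[10] (bfsConfig n 11 h t u v a i x [] heap out) =
      bfsConfig n 11 (h + 1) t u' v (n + n + (h + 1)) i' x' ((adj u').map Fin.val) heap
        (out ++ [(x', u'.val)]) := by
  have h1 : h + 1 < 2 ^ w := by lia
  have h2 : h + 1 < n + n + n := by lia
  have h3 : n + n + (h + 1) < 2 ^ w := by lia
  have h4 : n + n + (h + 1) < n + n + n := by lia
  have h5 : i' < 2 ^ w := by lia
  have h6 : i' < n + n + n := by lia
  have h7 : x' < 2 ^ w := by lia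
  have h8 : u'.val < 2 ^ w := by lia
  simp [Function.iterate_succ, bfsConfig, Nat.mod_eq_of_lt h1, h2, Nat.mod_eq_of_lt h3, h4,
    Nat.mod_eq_of_lt h5, h6, Nat.mod_eq_of_lt h7, Nat.mod_eq_of_lt h8, hu, hi, hx, ht.ne]

theorem run_start (hn : 4 * n ≤ 2 ^ w) (junk : ℕ → ℕ) :
    run bfsProgram w ⟨n, r, adj⟩ junk 11 =
      bfsConfig n 11 0 1 r 0 (n + r) 0 0 ((adj r).map Fin.val)
        (Function.update (Function.update (fun a => junk a % 2 ^ w) 0 r) (n + r) 0) [] := by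
  have h0 : 0 < n := r.pos
  have hr := r.isLt
  have h1 : 1 < 2 ^ w := by lia
  have h2 : n < 2 ^ w := by lia
  have h3 : n + n < 2 ^ w := by lia
  have h4 : n + n + n < 2 ^ w := by lia
  have h5 : n + r.val < 2 ^ w := by lia
  have h6 : r.val < 2 ^ w := by lia
  have h7 : n + r.val < n + n + n := by lia
  have hregs : (fun _ : Fin 10 => 0) = registers 0 0 0 0 0 0 0 0 0 0 := by
    funext j; fin_cases j <;> rfl
  simp [run, init, hregs, Function.iterate_succ, bfsConfig, Nat.mod_eq_of_lt h1,
    Nat.mod_eq_of_lt h2, Nat.mod_eq_of_lt h3, Nat.mod_eq_of_lt h4, Nat.mod_eq_of_lt h5,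
    Nat.mod_eq_of_lt h6, h7, h0, h4.le]

end WordRAM

namespace WordRAM
open Digraph

/-! ### The loop invariant of the machine -/

/-- The heap stores a state of breadth-first search with `t` discovered vertices: the queue in
the cells `0, …, n - 1`, the position in the queue of a discovered vertex `v` in the cell `n + v`,
and the position of the parent of the `i`-th queue entry in the cell `2 * n + i`. Nothing is said
about the cells that have not been written, among them the one for the parent of the root. -/
structure Represents {n : ℕ} (heap : ℕ → ℕ) (q : ℕ → Fin n) (p : ℕ → ℕ) (t : ℕ) : Prop where
  queue : ∀ i < t, heap i = q i
  index : ∀ i < t, heap (n + q i) = i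
  parent : ∀ i, 0 < i → i < t → heap (n + n + i) = p i

theorem Represents.append {n t h : ℕ} {heap : ℕ → ℕ} {q : ℕ → Fin n} {p : ℕ → ℕ} {v : Fin n}
    (hR : Represents heap q p t) (htn : t < n) (hv : ∀ i < t, q i ≠ v) :
    Represents (Function.update (Function.update (Function.update heap (n + v) t) t v)
      (n + n + t) h) (Function.update q t v) (Function.update p t h) (t + 1) := by
  have hvn := v.isLt
  constructor
  · intro i hi
    rcases Nat.lt_succ_iff_lt_or_eq.1 hi with hi | rfl
    · rw [Function.update_of_ne (by lia), Function.update_of_ne (by lia),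
        Function.update_of_ne (by lia), Function.update_of_ne hi.ne, hR.queue i hi]
    · rw [Function.update_of_ne (by lia), Function.update_self, Function.update_self]
  · intro i hi
    rcases Nat.lt_succ_iff_lt_or_eq.1 hi with hi | rfl
    · have hqi := (q i).isLt
      have hne : (q i).val ≠ v.val := fun heq => hv i hi (Fin.ext heq)
      rw [Function.update_of_ne hi.ne, Function.update_of_ne (by lia),
        Function.update_of_ne (by lia), Function.update_of_ne (by lia), hR.index i hi]
    · rw [Function.update_self, Function.update_of_ne (by lia),
        Function.update_of_ne (by lia), Function.update_self]
  · intro i h0 hi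
    rcases Nat.lt_succ_iff_lt_or_eq.1 hi with hi | rfl
    · rw [Function.update_of_ne (by lia), Function.update_of_ne (by lia),
        Function.update_of_ne (by lia), Function.update_of_ne hi.ne, hR.parent i h0 hi]
    · rw [Function.update_self, Function.update_self]

/-- The edges from the parents of the vertices at the queue positions `1, …, h` to these vertices. -/
def bfsEdges {n : ℕ} (q : ℕ → Fin n) (p : ℕ → ℕ) (h : ℕ) : List (Fin n × Fin n) :=
  (List.range h).map fun i => (q (p (i + 1)), q (i + 1))

variable {n w : ℕ} {r : Fin n} {adj : Fin n → List (Fin n)} {G : Digraph (Fin n)}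

/-- Scanning the rest of an out-list takes at most twelve steps per entry. -/
theorem exists_iterate_scan (hn : 4 * n ≤ 2 ^ w) {h u : ℕ} {out : List (ℕ × ℕ)}
    (cur : List (Fin n)) :
    ∀ {q : ℕ → Fin n} {p : ℕ → ℕ} {t : ℕ} {done : List (Fin n)} {heap : ℕ → ℕ} {v a i x : ℕ},
      IsBFSState G r q p h t done → Represents heap q p t → h < t →
      (∀ v ∈ cur, G.Adj (q h) v) →
      ∃ k ≤ 12 * cur.length, ∃ (q' : ℕ → Fin n) (p' : ℕ → ℕ) (t' : ℕ) (done' : List (Fin n))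
        (heap' : ℕ → ℕ) (v' a' i' x' : ℕ),
        (step bfsProgram w ⟨n, r, adj⟩)^[k]
          (bfsConfig n 11 h t u v a i x (cur.map Fin.val) heap out) =
          bfsConfig n 11 h t' u v' a' i' x' [] heap' out ∧
        IsBFSState G r q' p' h t' done' ∧ Represents heap' q' p' t' ∧ t ≤ t' ∧
        (∀ j < t, q' j = q j ∧ p' j = p j) ∧ (∀ v, v ∈ done ∨ v ∈ cur → v ∈ done') := by
  induction cur with
  | nil =>
    intro q p t done heap v a i x hs hR _ _
    exact ⟨0, by simp, q, p, t, done, heap, v, a, i, x, rfl, hs, hR, le_rfl,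
      fun _ _ => ⟨rfl, rfl⟩, by simp⟩
  | cons y ys ih =>
    intro q p t done heap v a i x hs hR hht hadj
    have htn : t ≤ n := by simpa using hs.le_card
    have hlookup := iterate_step_lookup (r := r) (adj := adj) (h := h) (t := t) (u := u) (a := a)
      (i := i) (x := x) (cur := ys.map Fin.val) (heap := heap) (out := out) hn y.isLt (v' := v)
    by_cases hy : ∃ j < t, q j = y
    · obtain ⟨j, hj, rfl⟩ := hy
      have hi : heap (n + q j) % 2 ^ w = j := by
        rw [hR.index j hj, Nat.mod_eq_of_lt (by lia)]
      have hx : heap j % 2 ^ w = q j := by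
        have := (q j).isLt
        rw [hR.queue j hj, Nat.mod_eq_of_lt (by lia)]
      rw [hi] at hlookup
      have hknown := iterate_step_known (r := r) (adj := adj) (h := h) (u := u) (a := n + q j)
        (x := x) (cur := ys.map Fin.val) (heap := heap) (out := out) hj htn hx
      obtain ⟨k, hk, q', p', t', done', heap', v', a', i', x', hrun, hs', hR', htt, hqp, hd⟩ :=
        ih (v := q j) (a := n + q j) (i := j) (x := q j) (hs.skip ⟨j, hj, rfl⟩) hR hht
          fun z hz => hadj z (List.mem_cons_of_mem _ hz)
      refine ⟨k + (3 + 3), by rw [List.length_cons]; lia, q', p', t', done', heap', v', a', i',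
        x', ?_, hs', hR', htt, hqp, ?_⟩
      · rw [Function.iterate_add_apply, Function.iterate_add_apply, List.map_cons, hlookup,
          hknown, hrun]
      · grind
    · push Not at hy
      -- the new vertex is not in the injective queue, so that the queue cannot be full
      have hcard := (hs.append hht (hadj y List.mem_cons_self) hy).le_card
      rw [Fintype.card_fin] at hcard
      obtain ⟨k, hk, q', p', t', done', heap', v', a', i', x', hrun, hs', hR', htt, hqp, hd⟩ :=
        ih (v := y) (a := n + n + t) (i := heap (n + y) % 2 ^ w)
          (x := if heap (n + y) % 2 ^ w < t then heap (heap (n + y) % 2 ^ w) % 2 ^ w else x)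
          (hs.append hht (hadj y List.mem_cons_self) hy) (hR.append hcard hy) (by lia)
          fun z hz => by
            rw [Function.update_of_ne hht.ne]; exact hadj z (List.mem_cons_of_mem _ hz)
      have hmiss : ∃ l ≤ 3, (step bfsProgram w ⟨n, r, adj⟩)^[l] (bfsConfig n 14 h t u y (n + y)
          (heap (n + y) % 2 ^ w) x (ys.map Fin.val) heap out) =
          bfsConfig n 18 h t u y (n + y) (heap (n + y) % 2 ^ w)
            (if heap (n + y) % 2 ^ w < t then heap (heap (n + y) % 2 ^ w) % 2 ^ w else x)
            (ys.map Fin.val) heap out := by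
        split_ifs with hi
        · refine ⟨3, le_rfl, iterate_step_mismatch hi htn ?_⟩
          have := (q (heap (n + y) % 2 ^ w)).isLt
          rw [hR.queue _ hi, Nat.mod_eq_of_lt (by lia)]
          exact fun heq => hy _ hi (Fin.ext heq)
        · exact ⟨2, by lia, iterate_step_unknown hi⟩
      obtain ⟨l, hl, hmiss⟩ := hmiss
      refine ⟨k + (6 + (l + 3)), by rw [List.length_cons]; lia, q', p', t', done', heap', v', a',
        i', x', ?_, hs', hR', by lia, fun j hj => ?_, ?_⟩
      · rw [Function.iterate_add_apply, Function.iterate_add_apply, Function.iterate_add_apply,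
          List.map_cons, hlookup, hmiss, iterate_step_append hn hcard (by lia), hrun]
      · have := hqp j (by lia)
        rwa [Function.update_of_ne hj.ne, Function.update_of_ne hj.ne] at this
      · grind

/-- The machine is about to scan the out-list of the `h`-th vertex in the queue. -/
def IsPopped (G : Digraph (Fin n)) (r : Fin n) (adj : Fin n → List (Fin n)) (c : Config 10 1) :
    Prop :=
  ∃ (q : ℕ → Fin n) (p : ℕ → ℕ) (h t v a i x : ℕ) (heap : ℕ → ℕ),
    IsBFSState G r q p h t [] ∧ Represents heap q p t ∧ h < t ∧
    c = bfsConfig n 11 h t (q h) v a i x ((adj (q h)).map Fin.val) heap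
      ((bfsEdges q p h).map fun e => (e.1.val, e.2.val))

/-- The machine has halted after a complete breadth-first search and has emitted its tree. -/
def IsFinished (G : Digraph (Fin n)) (r : Fin n) (c : Config 10 1) : Prop :=
  c.status = .halted ∧ c.top = n + n + n ∧ c.lazy = n + n + n ∧
    ∃ (q : ℕ → Fin n) (p : ℕ → ℕ) (t : ℕ), IsBFSState G r q p t t [] ∧
      c.out = (bfsEdges q p (t - 1)).map fun e => (e.1.val, e.2.val)

theorem IsPopped.length_out_lt {c : Config 10 1} (hc : IsPopped G r adj c) :
    c.out.length < n := by
  obtain ⟨q, p, h, t, v, a, i, x, heap, hs, -, hht, rfl⟩ := hc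
  have htn : t ≤ n := by simpa using hs.le_card
  simp only [bfsConfig, bfsEdges, List.length_map, List.length_range]
  lia

/-- After one out-list the machine either emits an edge or halts: if the queue is not exhausted,
then its next vertex is the head of an edge that has not been emitted yet. -/
theorem IsPopped.exists_iterate (hn : 4 * n ≤ 2 ^ w)
    (hadj : ∀ u v, v ∈ adj u ↔ G.Adj u v) {d : ℕ} (hd : ∀ v, (adj v).length ≤ d)
    {c : Config 10 1} (hc : IsPopped G r adj c) :
    ∃ k, 0 < k ∧ k ≤ 12 * d + 10 ∧
      (IsPopped G r adj ((step bfsProgram w ⟨n, r, adj⟩)^[k] c) ∧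
          c.out.length < ((step bfsProgram w ⟨n, r, adj⟩)^[k] c).out.length ∨
        IsFinished G r ((step bfsProgram w ⟨n, r, adj⟩)^[k] c)) := by
  obtain ⟨q, p, h, t, v, a, i, x, heap, hs, hR, hht, rfl⟩ := hc
  obtain ⟨k, hk, q', p', t', done', heap', v', a', i', x', hrun, hs', hR', htt, hqp, hdone⟩ :=
    exists_iterate_scan (r := r) (adj := adj) hn (h := h) (u := q h)
      (out := (bfsEdges q p h).map fun e => (e.1.val, e.2.val)) (adj (q h)) (v := v) (a := a)
      (i := i) (x := x) hs hR hht fun v hv => (hadj _ _).1 hv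
  have hk' : k ≤ 12 * d := hk.trans (Nat.mul_le_mul_left _ (hd _))
  have htn : t' ≤ n := by simpa using hs'.le_card
  have hnext : IsBFSState G r q' p' (h + 1) t' [] := hs'.advance fun v hv =>
    hdone v (Or.inr ((hadj _ _).2 (by rwa [(hqp h hht).1] at hv)))
  have hedges : bfsEdges q p h = bfsEdges q' p' h := by
    refine List.map_congr_left fun j hj => ?_
    have hj : j + 1 < t := by have := List.mem_range.1 hj; lia
    have hpj := hs.parent_lt (j + 1) j.succ_pos hj
    rw [(hqp _ hj).1, (hqp _ hj).2, (hqp _ (hpj.trans hj)).1]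
  rw [hedges] at hrun ⊢
  rcases Nat.lt_or_ge (h + 1) t' with hlt | hge
  · have hpar := hs'.parent_lt (h + 1) h.succ_pos hlt
    have hpop := iterate_step_pop (r := r) (adj := adj) (u := q h) (v := v') (a := a') (i := i')
      (x := x') (out := (bfsEdges q' p' h).map fun e => (e.1.val, e.2.val)) hn hlt htn
      (hR'.queue _ hlt) (hR'.parent _ h.succ_pos hlt) (by lia) (hR'.queue _ (hpar.trans hlt))
      (q' (p' (h + 1))).isLt
    refine ⟨10 + k, by lia, by lia, Or.inl ?_⟩
    rw [Function.iterate_add_apply, hrun, hpop]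
    refine ⟨⟨q', p', h + 1, t', v', n + n + (h + 1), p' (h + 1), q' (p' (h + 1)), heap',
      hnext, hR', hlt, ?_⟩, by simp [bfsConfig]⟩
    simp [bfsEdges, List.range_succ]
  · obtain rfl : h + 1 = t' := by lia
    refine ⟨4 + k, by lia, by lia, Or.inr ?_⟩
    rw [Function.iterate_add_apply, hrun, iterate_step_halt rfl (by lia)]
    exact ⟨rfl, rfl, rfl, q', p', h + 1, hnext, rfl⟩

theorem isPopped_run_start (hn : 4 * n ≤ 2 ^ w) (junk : ℕ → ℕ) :
    IsPopped G r adj (run bfsProgram w ⟨n, r, adj⟩ junk 11) := by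
  have hr := r.isLt
  rw [run_start hn]
  refine ⟨fun _ => r, fun _ => 0, 0, 1, _, _, _, _, _, .initial G r, ⟨?_, ?_, ?_⟩, one_pos, rfl⟩
  · intro i hi
    obtain rfl : i = 0 := by lia
    rw [Function.update_of_ne (by lia), Function.update_self]
  · intro i hi
    obtain rfl : i = 0 := by lia
    rw [Function.update_self]
  · intro i h0 hi
    lia

/-! ### Delay, space and correctness -/

theorem length_out_exec_le {k c : ℕ} (I : Input) (s : Config k c) (i : Instr k c) :
    s.out.length ≤ (exec w I s i).out.length := by
  cases i <;> simp only [exec] <;> (try split_ifs) <;> (try split) <;>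
    simp [Config.setReg, Config.adv, Config.goto, Config.err]

theorem length_out_step_le (P : Program) (I : Input) (s : Config P.numRegs P.numCursors) :
    s.out.length ≤ (step P w I s).out.length := by
  unfold step
  split
  · split
    · exact length_out_exec_le _ _ _
    · rfl
  · rfl

theorem monotone_length_out_run (P : Program) (I : Input) (junk : ℕ → ℕ) :
    Monotone fun t => (run P w I junk t).out.length :=
  monotone_nat_of_le_succ fun t => by
    simp only [run, Function.iterate_succ_apply']
    exact length_out_step_le _ _ _

theorem run_add (P : Program) (I : Input) (junk : ℕ → ℕ) (s k : ℕ) :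
    run P w I junk (k + s) = (step P w I)^[k] (run P w I junk s) :=
  Function.iterate_add_apply _ _ _ _

theorem run_eq_of_halted {P : Program} {I : Input} {junk : ℕ → ℕ} {s t : ℕ} (hst : s ≤ t)
    (hs : (run P w I junk s).status = .halted) : run P w I junk t = run P w I junk s := by
  obtain ⟨k, rfl⟩ := Nat.exists_eq_add_of_le' hst
  rw [run_add]
  refine Function.iterate_fixed ?_ k
  rw [step, hs]

variable {junk : ℕ → ℕ}

/-- From any time on, the next vertex is popped or the machine has halted after at most
`12 * d + 10` further steps. -/
theorem exists_isPopped_or_isFinished (hn : 4 * n ≤ 2 ^ w)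
    (hadj : ∀ u v, v ∈ adj u ↔ G.Adj u v) {d : ℕ} (hd : ∀ v, (adj v).length ≤ d) (hd0 : 1 ≤ d)
    (t : ℕ) :
    ∃ s, t ≤ s ∧ s ≤ t + (12 * d + 10) ∧
      (IsPopped G r adj (run bfsProgram w ⟨n, r, adj⟩ junk s) ∨
        IsFinished G r (run bfsProgram w ⟨n, r, adj⟩ junk s)) := by
  induction t with
  | zero => exact ⟨11, by lia, by lia, Or.inl (isPopped_run_start hn junk)⟩
  | succ t ih =>
    obtain ⟨s, hts, hst, hs⟩ := ih
    rcases hts.lt_or_eq with hts | rfl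
    · exact ⟨s, hts, by lia, hs⟩
    · rcases hs with hs | hs
      · obtain ⟨k, hk0, hk, hk'⟩ := hs.exists_iterate hn hadj hd
        refine ⟨k + t, by lia, by lia, ?_⟩
        rw [run_add]
        exact hk'.imp_left And.left
      · refine ⟨t + 1, le_rfl, by lia, Or.inr ?_⟩
        rwa [run_eq_of_halted t.le_succ hs.1]

theorem preprocessingDelayLE_bfsProgram (hn : 4 * n ≤ 2 ^ w)
    (hadj : ∀ u v, v ∈ adj u ↔ G.Adj u v) {d : ℕ} (hd : ∀ v, (adj v).length ≤ d) (hd0 : 1 ≤ d) :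
    PreprocessingDelayLE bfsProgram w ⟨n, r, adj⟩ junk 0 (44 * d) := by
  intro t _
  have hmono := monotone_length_out_run (w := w) bfsProgram ⟨n, r, adj⟩ junk
  obtain ⟨s, hts, hst, hs | hs⟩ :=
    exists_isPopped_or_isFinished (r := r) (junk := junk) hn hadj hd hd0 t
  · obtain ⟨k, -, hk, ⟨-, hlt⟩ | hfin⟩ := hs.exists_iterate hn hadj hd
    · rw [← run_add] at hlt
      exact Or.inl ((hmono hts).trans_lt (hlt.trans_le (hmono (by lia))))
    · rw [← run_add] at hfin
      right
      rw [run_eq_of_halted (s := k + s) (by lia) hfin.1, hfin.1]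
  · right
    rw [run_eq_of_halted (s := s) (by lia) hs.1, hs.1]

theorem exists_isFinished_run (hn : 4 * n ≤ 2 ^ w) (hadj : ∀ u v, v ∈ adj u ↔ G.Adj u v) :
    ∃ t, IsFinished G r (run bfsProgram w ⟨n, r, adj⟩ junk t) := by
  by_contra! hnot
  -- each popped vertex is followed by another one, with more edges emitted, but there are at
  -- most `n` edges
  have key : ∀ m, ∃ t, IsPopped G r adj (run bfsProgram w ⟨n, r, adj⟩ junk t) ∧
      m ≤ (run bfsProgram w ⟨n, r, adj⟩ junk t).out.length := by
    intro m
    induction m with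
    | zero => exact ⟨11, isPopped_run_start hn junk, Nat.zero_le _⟩
    | succ m ih =>
      obtain ⟨t, ht, hm⟩ := ih
      obtain ⟨k, -, -, ⟨hpop, hlt⟩ | hfin⟩ := ht.exists_iterate hn hadj
        (d := Finset.univ.sup fun v => (adj v).length)
        fun v => Finset.le_sup (f := fun v => (adj v).length) (Finset.mem_univ v)
      · exact ⟨k + t, by rwa [run_add], by rw [run_add]; lia⟩
      · exact absurd (by rwa [run_add]) (hnot (k + t))
  obtain ⟨t, ht, hm⟩ := key n
  exact absurd ht.length_out_lt hm.not_gt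

theorem IsFinished.hasEnumerated {c : Config 10 1} (hc : IsFinished G r c)
    (hreach : ∀ v, ∃ k, G.WalkOfLength r k v) :
    ∃ T : Digraph (Fin n), G.IsDirectedSpanningTree T r ∧
      (∀ v, T.distance r v = G.distance r v) ∧ HasEnumerated c T := by
  obtain ⟨hhalt, -, -, q, p, t, hs, hout⟩ := hc
  refine ⟨bfsTree q p t, hs.isDirectedSpanningTree hreach, hs.distance_bfsTree, hhalt,
    bfsEdges q p (t - 1), ?_, ?_, hout⟩
  · refine List.Nodup.map_on (fun i hi j hj hij => ?_) List.nodup_range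
    have hi := List.mem_range.1 hi
    have hj := List.mem_range.1 hj
    have := hs.inj (i + 1) (by lia) (j + 1) (by lia) (Prod.ext_iff.1 hij).2
    lia
  · intro u v
    simp only [bfsEdges, List.mem_map, List.mem_range, Prod.mk.injEq, bfsTree]
    constructor
    · rintro ⟨i, hi, hu, hv⟩
      exact ⟨i + 1, by lia, by lia, hu, hv⟩
    · rintro ⟨i, h0, hi, hu, hv⟩
      exact ⟨i - 1, by lia, by rwa [Nat.sub_add_cancel h0], by rwa [Nat.sub_add_cancel h0]⟩

end WordRAM

theorem Digraph.AdjacencyLists.length_list_le {n : ℕ} {G : Digraph (Fin n)}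
    (A : G.AdjacencyLists) (v : Fin n) : (A.list v).length ≤ G.maxOutDegree := by
  have hlen : (A.list v).length = G.outDegree v := by
    have hset : {w | G.Adj v w} = ((A.list v).toFinset : Set (Fin n)) := by
      ext w
      simp [A.mem_list]
    rw [Digraph.outDegree, hset, Set.ncard_coe_finset, List.toFinset_card_of_nodup (A.nodup v)]
  rw [hlen]
  exact Finset.le_sup (f := fun v => G.outDegree v) (Finset.mem_univ v)

theorem mainTheorem10 :
    ∃ (P : WordRAM.Program) (K C : ℕ),
      ∀ (n : ℕ) (G : Digraph (Fin n)) (A : G.AdjacencyLists) (r : Fin n),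
        (∃ T₀ : Digraph (Fin n), G.IsDirectedSpanningTree T₀ r) →
        ∀ (w : ℕ), K * n ≤ 2 ^ w →
        ∀ (junk : ℕ → ℕ),
          WordRAM.PreprocessingDelayLE P w ⟨n, r, A.list⟩ junk 0 (C * max 1 G.maxOutDegree) ∧
          ∃ (T : Digraph (Fin n)) (t : ℕ),
            G.IsDirectedSpanningTree T r ∧
            (∀ v, T.distance r v = G.distance r v) ∧
            WordRAM.HasEnumerated (WordRAM.run P w ⟨n, r, A.list⟩ junk t) T ∧
            (n ≤ C * (WordRAM.run P w ⟨n, r, A.list⟩ junk t).lazy ∧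
              (WordRAM.run P w ⟨n, r, A.list⟩ junk t).lazy ≤ C * n) ∧
            (n ≤ C * WordRAM.space P (WordRAM.run P w ⟨n, r, A.list⟩ junk t) ∧
              WordRAM.space P (WordRAM.run P w ⟨n, r, A.list⟩ junk t) ≤ C * n) := by
  refine ⟨WordRAM.bfsProgram, 4, 44, fun n G A r ⟨T₀, hT₀⟩ w hn junk => ⟨?_, ?_⟩⟩
  · exact WordRAM.preprocessingDelayLE_bfsProgram hn A.mem_list
      (fun v => (A.length_list_le v).trans (le_max_right _ _)) (le_max_left _ _)
  · obtain ⟨t, ht⟩ := WordRAM.exists_isFinished_run (r := r) (junk := junk) hn A.mem_list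
    obtain ⟨T, hT, hdist, henum⟩ := ht.hasEnumerated hT₀.exists_walkOfLength
    have hn0 : 0 < n := r.pos
    have htop := ht.2.1
    have hlazy := ht.2.2.1
    refine ⟨T, t, hT, hdist, henum, ⟨by lia, by lia⟩, ?_⟩
    simp only [WordRAM.space, htop]
    exact ⟨by lia, by lia⟩
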